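/- Let \(S\) be the period doubling substitution \(S(0)=01\), \(S(1)=00\) on the alphabet \(\{0,1\}\), let \(u=01000101\ldots\) be the one-sided sequence having every \(S^k(0)\), \(k\ge 0\), as a prefix, and let \(\Omega_{\mathrm{pd}}\) be the set of all two-sided sequences \(\omega\in\{0,1\}^{\mathbb Z}\) all of whose finite subwords occur in \(u\). For \(\lambda\in\mathbb R\) and \(\omega\in\Omega_{\mathrm{pd}}\), let \(H=H_{\lambda,\omega}\) be the bounded self-adjoint operator on \(\ell^2(\mathbb Z)\) given by \[ (H\psi)(n)=\psi(n-1)+\psi(n+1)+\lambda\,\omega_n\,\psi(n). \] Let \(\delta_m\), \(m\in\mathbb Z\), be the canonical basis of \(\ell^2(\mathbb Z)\). For \(T>0\) and \(p>0\) put \[ a(n,T)=\frac1T\int_0^\infty e^{-2t/T}\,\bigl|\bigl(e^{-itH}\delta_1\bigr)(n)\bigr|^2\,dt,\qquad \langle |X|^p\rangle(T)=\sum_{n\in\mathbb Z}|n|^p\,a(n,T),\qquad \beta^-(p)=\liminf_{T\to+\infty}\frac{\log\,\langle |X|^p\rangle(T)}{\log T}. \] Then for every \(\lambda\in\mathbb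 R\), every \(\omega\in\Omega_{\mathrm{pd}}\) and every \(p>0\), \[ \beta^-(p)\ \ge\ \frac{p-5}{2}. \] -/

import Mathlib

open scoped ENNReal

namespace PeriodDoubling

/-! ### The period doubling subshift -/

/-- The period doubling substitution on letters, `0 ↦ 01`, `1 ↦ 00`. -/
def substLetter (a : Fin 2) : List (Fin 2) :=
  if a = 0 then [0, 1] else [0, 0]

/-- The substitution extended to finite words by concatenation. -/
def subst (w : List (Fin 2)) : List (Fin 2) :=
  w.flatMap substLetter

/-- The word `S^k(0)`. -/
def word (k : ℕ) : List (Fin 2) :=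
  subst^[k] [0]

/-- The one-sided fixed point `u = 01000101…` of the substitution, indexed from `0`. The word
`S^n(0)` has length `2 ^ n > n` and is a prefix of all later ones (see `getElem?_word`), so its
letter at position `n` is the letter of `u` at position `n`, and the default value is never
used. -/
def fixedPoint (n : ℕ) : Fin 2 :=
  (word n).getD n 0

theorem length_subst (w : List (Fin 2)) : (subst w).length = 2 * w.length := by
  induction w with
  | nil => rfl
  | cons a w ih =>
    have h : (substLetter a).length = 2 := by unfold substLetter; split <;> rfl
    simp only [subst, List.flatMap_cons, List.length_append, List.length_cons] at ih ⊢
    omega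

theorem word_succ (k : ℕ) : word (k + 1) = subst (word k) :=
  Function.iterate_succ_apply' subst k [0]

theorem length_word (k : ℕ) : (word k).length = 2 ^ k := by
  induction k with
  | zero => rfl
  | succ k ih => rw [word_succ, length_subst, ih, pow_succ, mul_comm]

theorem word_prefix_succ (k : ℕ) : word k <+: word (k + 1) := by
  induction k with
  | zero => exact ⟨[1], rfl⟩
  | succ k ih =>
    obtain ⟨t, ht⟩ := ih
    refine ⟨subst t, ?_⟩
    calc word (k + 1) ++ subst t = subst (word k) ++ subst t := by rw [word_succ k]
      _ = subst (word k ++ t) := by simp [subst]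
      _ = word (k + 1 + 1) := by rw [ht, ← word_succ]

theorem word_prefix {k l : ℕ} (h : k ≤ l) : word k <+: word l := by
  induction l, h using Nat.le_induction with
  | base => exact List.prefix_refl _
  | succ l _ ih => exact ih.trans (word_prefix_succ l)

/-- Each word `S^k(0)` is a prefix of the sequence `u`. -/
theorem getElem?_word {k i : ℕ} (h : i < 2 ^ k) : (word k)[i]? = some (fixedPoint i) := by
  have hi : i < (word i).length := by rw [length_word]; exact Nat.lt_two_pow_self
  have hk : i < (word k).length := by rwa [length_word]
  have key : (word k)[i]? = (word i)[i]? := by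
    rcases le_total k i with hki | hik
    · obtain ⟨t, ht⟩ := word_prefix hki
      rw [← ht, List.getElem?_append_left hk]
    · obtain ⟨t, ht⟩ := word_prefix hik
      rw [← ht, List.getElem?_append_left hi]
  rw [key, fixedPoint, List.getD_eq_getElem _ _ hi, List.getElem?_eq_getElem hi]

/-- The period doubling subshift: all two-sided sequences over `{0, 1}` every finite subword
`ω_m … ω_{m+l-1}` of which occurs in the one-sided sequence `u`. -/
def subshift : Set (ℤ → Fin 2) :=
  {ω | ∀ (m : ℤ) (l : ℕ), ∃ j : ℕ, ∀ i < l, ω (m + i) = fixedPoint (j + i)}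

end PeriodDoubling

namespace QuantumDynamics

/-! ### Discrete Schrödinger operators on the line -/

/-- The Hilbert space `ℓ²(ℤ)` with complex coefficients. -/
abbrev Hilb : Type := lp (fun _ : ℤ => ℂ) 2

/-- Translation on `ℓ²(ℤ)`: `(translation k ψ)(n) = ψ(n + k)`. -/
noncomputable def translation (k : ℤ) : Hilb →L[ℂ] Hilb :=
  have hp : 0 < (2 : ℝ≥0∞).toReal := by norm_num
  LinearMap.mkContinuous
    { toFun := fun ψ => ⟨fun n => ψ (n + k), (memℓp_gen_iff hp).2
        (((memℓp_gen_iff hp).1 (lp.memℓp ψ)).comp_injective (add_left_injective k))⟩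
      map_add' := fun _ _ => by ext; rfl
      map_smul' := fun _ _ => by ext; rfl }
    1
    (fun ψ => by
      rw [one_mul, lp.norm_eq_tsum_rpow hp, lp.norm_eq_tsum_rpow hp]
      exact le_of_eq (congrArg (fun x : ℝ => x ^ (1 / (2 : ℝ≥0∞).toReal))
        ((Equiv.addRight k).tsum_eq (fun n => ‖ψ n‖ ^ (2 : ℝ≥0∞).toReal))))

/-- Multiplication by a bounded real potential `V` on `ℓ²(ℤ)`. -/
noncomputable def multiplication (V : lp (fun _ : ℤ => ℝ) ∞) : Hilb →L[ℂ] Hilb :=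
  lp.mapCLM 2 (fun n => ((V n : ℝ) : ℂ) • ContinuousLinearMap.id ℂ ℂ) (norm_nonneg V)
    (fun n => by
      simpa [norm_smul] using lp.norm_apply_le_norm ENNReal.top_ne_zero V n)

/-- The Schrödinger operator `(Hψ)(n) = ψ(n - 1) + ψ(n + 1) + V(n) ψ(n)` on `ℓ²(ℤ)`. -/
noncomputable def schrodinger (V : lp (fun _ : ℤ => ℝ) ∞) : Hilb →L[ℂ] Hilb :=
  translation (-1) + translation 1 + multiplication V

theorem schrodinger_apply (V : lp (fun _ : ℤ => ℝ) ∞) (ψ : Hilb) (n : ℤ) :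
    schrodinger V ψ n = ψ (n - 1) + ψ (n + 1) + (V n : ℂ) * ψ n := by
  rfl

/-- The canonical basis vector `δ_m` of `ℓ²(ℤ)`. -/
noncomputable def delta (m : ℤ) : Hilb :=
  lp.single 2 m (1 : ℂ)

/-! ### Dynamics -/

/-- The time evolution `ψ(t) = exp(-itH) ψ`. -/
noncomputable def evolution (H : Hilb →L[ℂ] Hilb) (t : ℝ) (ψ : Hilb) : Hilb :=
  NormedSpace.exp ((-(t : ℂ) * Complex.I) • H) ψ

/-- The time-averaged probability of being at site `n`,
`a(n, T) = (1 / T) ∫_0^∞ e^{-2t/T} |ψ(t, n)|² dt` (for `T > 0`). -/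
noncomputable def avgProb (H : Hilb →L[ℂ] Hilb) (ψ : Hilb) (n : ℤ) (T : ℝ) : ℝ≥0∞ :=
  ENNReal.ofReal (1 / T) *
    ∫⁻ t in Set.Ioi (0 : ℝ), ENNReal.ofReal (Real.exp (-2 * t / T) * ‖evolution H t ψ n‖ ^ 2)

/-- The time-averaged moment of order `p` of the position operator,
`⟨|X|_ψ^p⟩(T) = ∑_n |n|^p a(n, T)`. -/
noncomputable def avgMoment (H : Hilb →L[ℂ] Hilb) (ψ : Hilb) (p T : ℝ) : ℝ≥0∞ :=
  ∑' n : ℤ, ENNReal.ofReal (|(n : ℝ)| ^ p) * avgProb H ψ n T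

/-- The lower growth exponent
`β⁻(p) = liminf_{T → ∞} log ⟨|X|_ψ^p⟩(T) / log T`, as an extended real number. -/
noncomputable def betaMinus (H : Hilb →L[ℂ] Hilb) (ψ : Hilb) (p : ℝ) : EReal :=
  Filter.liminf (fun T : ℝ => ENNReal.log (avgMoment H ψ p T) / (Real.log T : EReal))
    Filter.atTop

end QuantumDynamics

namespace PeriodDoubling

/-- The potential `V_{λ,ω}(n) = λ ω_n`. -/
noncomputable def potential (lam : ℝ) (ω : ℤ → Fin 2) : lp (fun _ : ℤ => ℝ) ∞ :=
  ⟨fun n => lam * ((ω n : ℕ) : ℝ), memℓp_infty ⟨|lam|, by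
    rintro _ ⟨n, rfl⟩
    have h : ((ω n : ℕ) : ℝ) ≤ 1 := by exact_mod_cast Nat.le_of_lt_succ (ω n).isLt
    simpa [abs_mul] using mul_le_mul_of_nonneg_left h (abs_nonneg lam)⟩⟩

/-- The period doubling Hamiltonian with coupling constant `lam` and phase `ω`. -/
noncomputable def hamiltonian (lam : ℝ) (ω : ℤ → Fin 2) :
    QuantumDynamics.Hilb →L[ℂ] QuantumDynamics.Hilb :=
  QuantumDynamics.schrodinger (potential lam ω)

end PeriodDoubling

/-! ### Self-adjointness and unitary time evolution -/

namespace QuantumDynamics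

open MeasureTheory Set Filter Topology

/-! Since both letters have images starting with `0`, `ω` vanishes on one of the two cosets of `2ℤ`.
At energy zero, the transfer matrix over two sites is then minus a unipotent triangular matrix, and
all these commute, so products over `N` sites grow only like `N`. The bound survives at complex
energies of modulus at most `N⁻²`; in `exists_sites_le_norm_add_norm` a weighted norm replaces the
matrix products.

The single energy `iε` with `ε = 2/T` suffices, with no integration over energies. The Laplace
transform of the evolution at `ε` solves the resolvent equation at `iε` with a source at `1`
(`laplace_resolvent_eq`), so for `N ≈ √(T/2)` it is at least of order `1/N` on `N` pairs of
neighbouring sites at distance about `N`. By Cauchy-Schwarz (`le_avgProb`) it bounds `a(n,T)` below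
by `2 T⁻² |·|²`. Summation gives a moment of order at least `N · N^p · T⁻² · N⁻²`, that is
`T^((p-5)/2)`. -/

theorem isSelfAdjoint_schrodinger (V : lp (fun _ : ℤ => ℝ) ∞) :
    IsSelfAdjoint (schrodinger V) := by
  rw [ContinuousLinearMap.isSelfAdjoint_iff_isSymmetric]
  intro x y
  change inner ℂ (schrodinger V x) y = inner ℂ x (schrodinger V y)
  have shift : ∀ (k : ℤ) (x y : Hilb),
      inner ℂ (translation k x) y = inner ℂ x (translation (-k) y) := by
    intro k x y
    rw [lp.inner_eq_tsum, lp.inner_eq_tsum,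
      ← (Equiv.addRight k).tsum_eq (fun n => inner ℂ (x n) (translation (-k) y n))]
    refine tsum_congr fun n => ?_
    change inner ℂ (x (n + k)) (y n) = inner ℂ (x (n + k)) (y (n + k + -k))
    rw [add_neg_cancel_right]
  have mult : inner ℂ (multiplication V x) y = inner ℂ x (multiplication V y) := by
    rw [lp.inner_eq_tsum, lp.inner_eq_tsum]
    refine tsum_congr fun n => ?_
    change inner ℂ ((V n : ℂ) * x n) (y n) = inner ℂ (x n) ((V n : ℂ) * y n)
    simp only [RCLike.inner_apply, map_mul, Complex.conj_ofReal]
    ring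
  have h1 := shift (-1) x y
  rw [neg_neg] at h1
  simp only [schrodinger, add_apply, inner_add_left, inner_add_right,
    h1, shift 1, mult]
  ring

theorem norm_evolution {H : Hilb →L[ℂ] Hilb} (hH : IsSelfAdjoint H) (t : ℝ) (ψ : Hilb) :
    ‖evolution H t ψ‖ = ‖ψ‖ := by
  have ht : IsSelfAdjoint (-(t : ℂ)) := by simp [isSelfAdjoint_iff]
  have h := (selfAdjoint.expUnitary ⟨(-(t : ℂ)) • H, IsSelfAdjoint.smul ht hH⟩).2
  rw [selfAdjoint.expUnitary_coe, smul_smul, mul_comm] at h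
  exact ContinuousLinearMap.norm_map_of_mem_unitary h ψ

theorem hasDerivAt_evolution_apply (H : Hilb →L[ℂ] Hilb) (ψ : Hilb) (n : ℤ) (t : ℝ) :
    HasDerivAt (fun t : ℝ => evolution H t ψ n) (-Complex.I * H (evolution H t ψ) n) t := by
  have h1 : HasDerivAt (fun s : ℂ => NormedSpace.exp (s • H))
      (H * NormedSpace.exp ((-(t : ℂ) * Complex.I) • H)) (-(t : ℂ) * Complex.I) :=
    hasDerivAt_exp_smul_const' H _
  have h2 : HasDerivAt (fun t : ℝ => -(t : ℂ) * Complex.I) (-Complex.I) t := by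
    simpa using ((Complex.ofRealCLM.hasDerivAt (x := t)).neg.mul_const Complex.I)
  have h3 := h1.scomp t h2
  let L : (Hilb →L[ℂ] Hilb) →L[ℂ] ℂ :=
    (lp.evalCLM ℂ (fun _ : ℤ => ℂ) 2 n).comp (ContinuousLinearMap.apply ℂ Hilb ψ)
  exact (L.restrictScalars ℝ).hasFDerivAt.comp_hasDerivAt t h3

theorem continuous_evolution_apply (H : Hilb →L[ℂ] Hilb) (ψ : Hilb) (n : ℤ) :
    Continuous (fun t : ℝ => evolution H t ψ n) :=
  continuous_iff_continuousAt.2 fun t => (hasDerivAt_evolution_apply H ψ n t).continuousAt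

theorem evolution_zero (H : Hilb →L[ℂ] Hilb) (ψ : Hilb) : evolution H 0 ψ = ψ := by
  simp [evolution]

theorem norm_evolution_apply_le {H : Hilb →L[ℂ] Hilb} (hH : IsSelfAdjoint H) (t : ℝ)
    (ψ : Hilb) (n : ℤ) : ‖evolution H t ψ n‖ ≤ ‖ψ‖ :=
  (lp.norm_apply_le_norm two_ne_zero _ n).trans (norm_evolution hH t ψ).le

/-! ### Laplace transform of the evolution and the resolvent equation -/

/-- The Laplace transform `∫_0^∞ e^{-εt} ψ(t, n) dt` of the time evolution at the site `n`. -/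
noncomputable def laplace (H : Hilb →L[ℂ] Hilb) (ψ : Hilb) (ε : ℝ) (n : ℤ) : ℂ :=
  ∫ t in Ioi (0 : ℝ), (Real.exp (-ε * t) : ℂ) * evolution H t ψ n

theorem integrableOn_exp_mul_of_bounded {E : Type*} [NormedRing E] [NormedAlgebra ℝ E]
    {f : ℝ → E} (hf : Continuous f) {C : ℝ} (hC : ∀ t, ‖f t‖ ≤ C) {ε : ℝ} (hε : 0 < ε) :
    IntegrableOn (fun t => Real.exp (-ε * t) • f t) (Ioi 0) := by
  exact Integrable.smul_bdd (exp_neg_integrableOn_Ioi 0 hε) C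
    hf.aestronglyMeasurable (ae_of_all _ hC)

theorem integrableOn_laplace {H : Hilb →L[ℂ] Hilb} (hH : IsSelfAdjoint H) (ψ : Hilb)
    {ε : ℝ} (hε : 0 < ε) (n : ℤ) :
    IntegrableOn (fun t : ℝ => (Real.exp (-ε * t) : ℂ) * evolution H t ψ n) (Ioi 0) := by
  simpa only [Complex.real_smul] using integrableOn_exp_mul_of_bounded
    (continuous_evolution_apply H ψ n) (fun t => norm_evolution_apply_le hH t ψ n) hε

/-- The Laplace transform at `ε` solves the resolvent equation at the energy `iε`. -/
theorem laplace_resolvent_eq (V : lp (fun _ : ℤ => ℝ) ∞) (ψ : Hilb) {ε : ℝ} (hε : 0 < ε)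
    (n : ℤ) :
    laplace (schrodinger V) ψ ε (n - 1) + laplace (schrodinger V) ψ ε (n + 1) +
        (V n : ℂ) * laplace (schrodinger V) ψ ε n =
      Complex.I * ε * laplace (schrodinger V) ψ ε n - Complex.I * ψ n := by
  set H := schrodinger V with hHdef
  have hH : IsSelfAdjoint H := isSelfAdjoint_schrodinger V
  have hi := integrableOn_laplace hH ψ hε
  set g : ℝ → ℂ := fun t => (Real.exp (-ε * t) : ℂ) * evolution H t ψ n with hg
  set g' : ℝ → ℂ := fun t =>
    -ε * ((Real.exp (-ε * t) : ℂ) * evolution H t ψ n) +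
      -Complex.I * (((Real.exp (-ε * t) : ℂ) * evolution H t ψ (n - 1) +
        (Real.exp (-ε * t) : ℂ) * evolution H t ψ (n + 1)) +
        (V n : ℂ) * ((Real.exp (-ε * t) : ℂ) * evolution H t ψ n)) with hg'
  have hderiv : ∀ t ∈ Ici (0 : ℝ), HasDerivAt g (g' t) t := by
    intro t _
    have h1 : HasDerivAt (fun t : ℝ => (Real.exp (-ε * t) : ℂ))
        ((Real.exp (-ε * t) * (-ε) : ℝ) : ℂ) t := by
      apply HasDerivAt.ofReal_comp
      simpa using ((hasDerivAt_id t).const_mul (-ε)).exp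
    have h2 := hasDerivAt_evolution_apply H ψ n t
    rw [hHdef, schrodinger_apply] at h2
    refine (h1.mul h2).congr_deriv ?_
    simp only [hg', ← hHdef]
    push_cast
    ring
  have hint : IntegrableOn g' (Ioi 0) :=
    ((hi n).const_mul _).add ((((hi _).add (hi _)).add ((hi n).const_mul _)).const_mul _)
  have hlim : Tendsto g atTop (𝓝 0) := by
    have h0 : Tendsto (fun t : ℝ => Real.exp (-ε * t) * ‖ψ‖) atTop (𝓝 0) := by
      rw [← zero_mul ‖ψ‖]
      refine Tendsto.mul_const _ (Real.tendsto_exp_atBot.comp ?_)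
      exact tendsto_id.const_mul_atTop_of_neg (neg_lt_zero.2 hε)
    refine squeeze_zero_norm (fun t => ?_) h0
    rw [hg, norm_mul, Complex.norm_real, Real.norm_of_nonneg (Real.exp_pos _).le]
    exact mul_le_mul_of_nonneg_left (norm_evolution_apply_le hH t ψ n) (Real.exp_pos _).le
  have key := integral_Ioi_of_hasDerivAt_of_tendsto' hderiv hint hlim
  have e : ∫ t in Ioi (0 : ℝ), g' t = -ε * laplace H ψ ε n +
      -Complex.I * ((laplace H ψ ε (n - 1) + laplace H ψ ε (n + 1)) +
        (V n : ℂ) * laplace H ψ ε n) := by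
    exact ((integral_add ((hi n).const_mul _)
      ((((hi _).add (hi _)).add ((hi n).const_mul _)).const_mul _)).trans
      (congrArg₂ (· + ·) (integral_const_mul _ _) ((integral_const_mul _ _).trans
        (congrArg (-Complex.I * ·) ((integral_add ((hi _).add (hi _)) ((hi n).const_mul _)).trans
          (congrArg₂ (· + ·) (integral_add (hi _) (hi _)) (integral_const_mul _ _)))))))
  rw [e, hg] at key
  simp only [mul_zero, Real.exp_zero, Complex.ofReal_one, one_mul, evolution_zero] at key
  linear_combination Complex.I * key +
    (laplace H ψ ε (n - 1) + laplace H ψ ε (n + 1) + (V n : ℂ) * laplace H ψ ε n) *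
      Complex.I_sq

/-- By Cauchy-Schwarz, the Laplace transform bounds the averaged probabilities from below. -/
theorem le_avgProb {H : Hilb →L[ℂ] Hilb} (hH : IsSelfAdjoint H) (ψ : Hilb) (n : ℤ) {T : ℝ}
    (hT : 0 < T) :
    ENNReal.ofReal (2 / T ^ 2 * ‖laplace H ψ (2 / T) n‖ ^ 2) ≤ avgProb H ψ n T := by
  have hε : 0 < 2 / T := by positivity
  set ε := 2 / T with hεdef
  set f : ℝ → ℝ := fun t => ‖evolution H t ψ n‖ with hf
  have hfc : Continuous f := (continuous_evolution_apply H ψ n).norm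
  have hfb : ∀ t, ‖f t‖ ≤ ‖ψ‖ := fun t => by
    rw [hf, norm_norm]; exact norm_evolution_apply_le hH t ψ n
  have i0 : IntegrableOn (fun t : ℝ => Real.exp (-ε * t)) (Ioi 0) :=
    exp_neg_integrableOn_Ioi 0 hε
  have i1 : IntegrableOn (fun t => Real.exp (-ε * t) * f t) (Ioi 0) :=
    integrableOn_exp_mul_of_bounded hfc hfb hε
  have i2 : IntegrableOn (fun t => Real.exp (-ε * t) * f t ^ 2) (Ioi 0) :=
    integrableOn_exp_mul_of_bounded (hfc.pow 2) (C := ‖ψ‖ ^ 2)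
      (fun t => by
        rw [Pi.pow_apply, norm_pow]; exact pow_le_pow_left₀ (norm_nonneg _) (hfb t) 2) hε
  set s := ∫ t in Ioi (0 : ℝ), Real.exp (-ε * t) * f t with hs
  have hus : ‖laplace H ψ ε n‖ ≤ s := by
    refine (norm_integral_le_integral_norm _).trans_eq ?_
    refine integral_congr_ae (ae_of_all _ fun t => ?_)
    simp only [norm_mul, Complex.norm_real, Real.norm_of_nonneg (Real.exp_pos _).le, hf]
  have hexp : ∫ t in Ioi (0 : ℝ), Real.exp (-ε * t) = 1 / ε := by
    rw [integral_exp_mul_Ioi (neg_lt_zero.2 hε)]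
    simp [neg_div_neg_eq]
  have hcs : ε * s ^ 2 ≤ ∫ t in Ioi (0 : ℝ), Real.exp (-ε * t) * f t ^ 2 := by
    -- Cauchy-Schwarz as a variance: `ε s` is the mean of `f` for the probability density `ε
    -- e^{-εt}`, and `(f - ε s)² ≥ 0` is integrated.
    have hle : ∫ t in Ioi (0 : ℝ), (2 * (ε * s) * (Real.exp (-ε * t) * f t) -
        (ε * s) ^ 2 * Real.exp (-ε * t)) ≤
        ∫ t in Ioi (0 : ℝ), Real.exp (-ε * t) * f t ^ 2 := by
      refine integral_mono ((i1.const_mul _).sub (i0.const_mul _)) i2 fun t => ?_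
      have := mul_nonneg (Real.exp_pos (-ε * t)).le (sq_nonneg (f t - ε * s))
      simp only
      linarith
    rw [integral_sub (i1.const_mul _) (i0.const_mul _), integral_const_mul,
      integral_const_mul, hexp, ← hs] at hle
    refine le_trans (le_of_eq ?_) hle
    field_simp
    ring
  have havg : avgProb H ψ n T =
      ENNReal.ofReal (1 / T * ∫ t in Ioi (0 : ℝ), Real.exp (-ε * t) * f t ^ 2) := by
    rw [avgProb, ENNReal.ofReal_mul (by positivity), ofReal_integral_eq_lintegral_ofReal i2
      (ae_of_all _ fun t => by positivity)]
    congr 1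
    refine lintegral_congr fun t => ?_
    rw [hεdef, hf]
    congr 4
    ring
  rw [havg]
  refine ENNReal.ofReal_le_ofReal ?_
  calc 2 / T ^ 2 * ‖laplace H ψ ε n‖ ^ 2 ≤ 2 / T ^ 2 * s ^ 2 := by gcongr
    _ = 1 / T * (ε * s ^ 2) := by rw [hεdef]; field_simp
    _ ≤ _ := by gcongr

/-! ### Weighted transfer estimates -/

/-- The weighted size of the pair of values of `u` at the sites `n` and `n + 1`. -/
noncomputable def pairSize (w : ℤ → ℝ) (u : ℤ → ℂ) (n : ℤ) : ℝ :=
  w n * ‖u n‖ + w (n + 1) * ‖u (n + 1)‖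

section Transfer

variable {w : ℤ → ℝ} {u : ℤ → ℂ} {V : ℤ → ℝ} {z : ℂ} {q : ℝ}

/-- In `u (n + 1) = (z - V n) u n - u (n - 1)` the last term keeps its weight because `w` has period
two; only the term in `u n` costs anything, and `hstep` bounds that cost by `q`. -/
theorem pairSize_le_pred (hw : ∀ n, 0 ≤ w n) (hper : ∀ n, w (n + 1) = w (n - 1)) (hq : 0 ≤ q)
    (hstep : ∀ n, w (n + 1) * ‖z - V n‖ ≤ q * w n) {n : ℤ}
    (heq : u (n - 1) + u (n + 1) + V n * u n = z * u n) :
    pairSize w u n ≤ (1 + q) * pairSize w u (n - 1) := by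
  have e : u (n + 1) = (z - V n) * u n - u (n - 1) := by linear_combination heq
  have h1 : ‖u (n + 1)‖ ≤ ‖z - V n‖ * ‖u n‖ + ‖u (n - 1)‖ := by
    rw [e, ← norm_mul]; exact norm_sub_le _ _
  have h2 := mul_le_mul_of_nonneg_left h1 (hw (n + 1))
  have h3 := mul_le_mul_of_nonneg_right (hstep n) (norm_nonneg (u n))
  have h4 := mul_nonneg hq (mul_nonneg (hw (n - 1)) (norm_nonneg (u (n - 1))))
  simp only [pairSize, sub_add_cancel]
  rw [mul_add, hper n] at h2
  rw [hper n] at h3 ⊢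
  linarith

theorem pairSize_pred_le (hw : ∀ n, 0 ≤ w n) (hper : ∀ n, w (n + 1) = w (n - 1)) (hq : 0 ≤ q)
    (hstep : ∀ n, w (n + 1) * ‖z - V n‖ ≤ q * w n) {n : ℤ}
    (heq : u (n - 1) + u (n + 1) + V n * u n = z * u n) :
    pairSize w u (n - 1) ≤ (1 + q) * pairSize w u n := by
  have e : u (n - 1) = (z - V n) * u n - u (n + 1) := by linear_combination heq
  have h1 : ‖u (n - 1)‖ ≤ ‖z - V n‖ * ‖u n‖ + ‖u (n + 1)‖ := by
    rw [e, ← norm_mul]; exact norm_sub_le _ _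
  have h2 := mul_le_mul_of_nonneg_left h1 (hw (n + 1))
  have h3 := mul_le_mul_of_nonneg_right (hstep n) (norm_nonneg (u n))
  have h4 := mul_nonneg hq (mul_nonneg (hw (n + 1)) (norm_nonneg (u (n + 1))))
  simp only [pairSize, sub_add_cancel]
  rw [← hper n]
  linarith

/-- The iteration uses the equation only at the sites `2, …, m + 1`, so it never meets the source at
`1`. The leftward version likewise uses only sites at most `0`. -/
theorem pairSize_one_le (hw : ∀ n, 0 ≤ w n) (hper : ∀ n, w (n + 1) = w (n - 1)) (hq : 0 ≤ q)
    (hstep : ∀ n, w (n + 1) * ‖z - V n‖ ≤ q * w n)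
    (heq : ∀ n, n ≠ 1 → u (n - 1) + u (n + 1) + V n * u n = z * u n) (m : ℕ) :
    pairSize w u 1 ≤ (1 + q) ^ m * pairSize w u (m + 1) := by
  induction m with
  | zero => simp
  | succ m ih =>
    have h := pairSize_pred_le hw hper hq hstep (heq (((m + 1 : ℕ) : ℤ) + 1) (by omega))
    rw [add_sub_cancel_right, Nat.cast_succ] at h
    rw [pow_succ, mul_assoc, Nat.cast_succ]
    exact ih.trans (mul_le_mul_of_nonneg_left h (by positivity))

theorem pairSize_zero_le (hw : ∀ n, 0 ≤ w n) (hper : ∀ n, w (n + 1) = w (n - 1)) (hq : 0 ≤ q)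
    (hstep : ∀ n, w (n + 1) * ‖z - V n‖ ≤ q * w n)
    (heq : ∀ n, n ≠ 1 → u (n - 1) + u (n + 1) + V n * u n = z * u n) (m : ℕ) :
    pairSize w u 0 ≤ (1 + q) ^ m * pairSize w u (-m) := by
  induction m with
  | zero => simp
  | succ m ih =>
    have h := pairSize_le_pred hw hper hq hstep (heq (-(m : ℤ)) (by omega))
    rw [show -(m : ℤ) - 1 = -((m + 1 : ℕ) : ℤ) by push_cast; ring] at h
    rw [pow_succ, mul_assoc]
    exact ih.trans (mul_le_mul_of_nonneg_left h (by positivity))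

end Transfer

/-- If the potential vanishes on a sublattice of index two, solutions of the resolvent equation
with source at the site `1` and an energy of modulus at most `N⁻²` decay at most like `N⁻¹` on
one of the two half-lines up to distance `2 N`. -/
theorem exists_sites_le_norm_add_norm {u : ℤ → ℂ} {V : ℤ → ℝ} {z : ℂ} {σ : ℤ} {K : ℝ} {N : ℕ}
    (hN : 1 ≤ N) (hK : 1 ≤ K) (hz : ‖z‖ ≤ 1 / (N : ℝ) ^ 2) (hV : ∀ n, ‖z - V n‖ ≤ K)
    (hV0 : ∀ n, Even (n + σ) → V n = 0)
    (heq : ∀ n, n ≠ 1 → u (n - 1) + u (n + 1) + V n * u n = z * u n)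
    (hsource : ‖u 0 + u 2 + V 1 * u 1 - z * u 1‖ = 1) :
    ∃ g : ℕ → ℤ, g.Injective ∧ ∀ j < N, (N : ℝ) ≤ |(g j : ℝ)| ∧ (N : ℝ) ≤ |((g j + 1 : ℤ) : ℝ)| ∧
      Real.exp (-(2 * K)) / (2 * K) ≤ N * (‖u (g j)‖ + ‖u (g j + 1)‖) := by
  have hN1 : (1 : ℝ) ≤ N := by exact_mod_cast hN
  have hN0 : (0 : ℝ) < N := by linarith
  -- These weights balance the two kinds of site with `q = K / N`: where `V` vanishes the cost is `N
  -- ‖z‖ ≤ 1 / N`, elsewhere `‖z - V n‖ ≤ K = (K / N) * N`.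
  set w : ℤ → ℝ := fun n => if Even (n + σ) then 1 else N with hw
  have hw1 : ∀ n, 1 ≤ w n := fun n => by simp only [hw]; split_ifs <;> linarith
  have hwN : ∀ n, w n ≤ N := fun n => by simp only [hw]; split_ifs <;> linarith
  have hw0 : ∀ n, 0 ≤ w n := fun n => by linarith [hw1 n]
  have hper : ∀ n, w (n + 1) = w (n - 1) := fun n => by
    have : Even (n + 1 + σ) ↔ Even (n - 1 + σ) := by
      rw [show n + 1 + σ = (n - 1 + σ) + 2 by ring, Int.even_add]; simp
    simp only [hw, this]
  have hq : 0 ≤ K / N := by positivity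
  have hstep : ∀ n, w (n + 1) * ‖z - V n‖ ≤ K / N * w n := fun n => by
    by_cases h : Even (n + σ)
    · have h' : ¬ Even (n + 1 + σ) := by
        rw [show n + 1 + σ = (n + σ) + 1 by ring, Int.even_add_one]; exact not_not.2 h
      simp only [hw, if_pos h, if_neg h', hV0 n h, Complex.ofReal_zero, sub_zero, mul_one]
      calc (N : ℝ) * ‖z‖ ≤ N * (1 / (N : ℝ) ^ 2) := by gcongr
        _ = 1 / N := by field_simp
        _ ≤ K / N := by gcongr
    · have h' : Even (n + 1 + σ) := by
        rw [show n + 1 + σ = (n + σ) + 1 by ring, Int.even_add_one]; exact h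
      simp only [hw, if_neg h, if_pos h', one_mul]
      rw [div_mul_cancel₀ _ hN0.ne']
      exact hV n
  -- The source forces a nontrivial value near `1`, so one of the pairs at `0` and `1` has size at
  -- least `1 / (2K)`; this decides the half-line.
  have hinit : 1 ≤ K * (pairSize w u 0 + pairSize w u 1) := by
    have h1 : (1 : ℝ) ≤ ‖u 0‖ + ‖u 2‖ + K * ‖u 1‖ := by
      rw [← hsource, show u 0 + u 2 + V 1 * u 1 - z * u 1 = (u 0 + u 2) - (z - V 1) * u 1 by ring]
      refine (norm_sub_le _ _).trans (add_le_add (norm_add_le _ _) ?_)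
      rw [norm_mul]
      exact mul_le_mul_of_nonneg_right (hV 1) (norm_nonneg _)
    have h2 : ‖u 0‖ + ‖u 1‖ ≤ pairSize w u 0 :=
      add_le_add (le_mul_of_one_le_left (norm_nonneg _) (hw1 _))
        (le_mul_of_one_le_left (norm_nonneg _) (hw1 _))
    have h3 : ‖u 1‖ + ‖u 2‖ ≤ pairSize w u 1 :=
      add_le_add (le_mul_of_one_le_left (norm_nonneg _) (hw1 _))
        (le_mul_of_one_le_left (norm_nonneg _) (hw1 _))
    have h4 : ‖u 0‖ + ‖u 2‖ ≤ K * (‖u 0‖ + ‖u 2‖) :=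
      le_mul_of_one_le_left (by positivity) hK
    have h5 : K * ((‖u 0‖ + ‖u 1‖) + (‖u 1‖ + ‖u 2‖)) ≤
        K * (pairSize w u 0 + pairSize w u 1) := by gcongr
    have h6 : 0 ≤ K * ‖u 1‖ := by positivity
    linarith
  have hpow : ∀ m : ℕ, m ≤ 2 * N → (1 + K / N) ^ m ≤ Real.exp (2 * K) := fun m hm => by
    calc (1 + K / N) ^ m ≤ (1 + K / N) ^ (2 * N) :=
          pow_le_pow_right₀ (by linarith) hm
      _ ≤ (Real.exp (K / N)) ^ (2 * N) :=
          pow_le_pow_left₀ (by linarith) (by linarith [Real.add_one_le_exp (K / N)]) _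
      _ = Real.exp (2 * K) := by
          rw [← Real.exp_nat_mul]; congr 1; push_cast; field_simp
  have hfin : ∀ (n : ℤ) (m : ℕ) (a : ℝ), m ≤ 2 * N → 1 / (2 * K) ≤ a →
      a ≤ (1 + K / N) ^ m * pairSize w u n →
      Real.exp (-(2 * K)) / (2 * K) ≤ N * (‖u n‖ + ‖u (n + 1)‖) := by
    intro n m a hm ha hle
    have h1 : pairSize w u n ≤ N * (‖u n‖ + ‖u (n + 1)‖) := by
      rw [mul_add]
      exact add_le_add (mul_le_mul_of_nonneg_right (hwN _) (norm_nonneg _))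
        (mul_le_mul_of_nonneg_right (hwN _) (norm_nonneg _))
    have h2 : 1 / (2 * K) ≤ Real.exp (2 * K) * (N * (‖u n‖ + ‖u (n + 1)‖)) :=
      ha.trans (hle.trans ((mul_le_mul_of_nonneg_left h1 (by positivity)).trans
        (mul_le_mul_of_nonneg_right (hpow m hm) (by positivity))))
    calc Real.exp (-(2 * K)) / (2 * K) = Real.exp (-(2 * K)) * (1 / (2 * K)) := by ring
      _ ≤ Real.exp (-(2 * K)) * (Real.exp (2 * K) * (N * (‖u n‖ + ‖u (n + 1)‖))) := by gcongr
      _ = N * (‖u n‖ + ‖u (n + 1)‖) := by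
          rw [← mul_assoc, ← Real.exp_add, neg_add_cancel, Real.exp_zero, one_mul]
  have hor : 1 / (2 * K) ≤ pairSize w u 1 ∨ 1 / (2 * K) ≤ pairSize w u 0 := by
    by_contra! h
    have hlt := mul_lt_mul_of_pos_left (add_lt_add h.2 h.1) (by linarith : 0 < K)
    have : K * (1 / (2 * K) + 1 / (2 * K)) = 1 := by field_simp; norm_num
    linarith
  rcases hor with h | h
  · refine ⟨fun j => ((N + j : ℕ) : ℤ) + 1, fun a b hab => by simpa using hab, fun j hj => ⟨?_, ?_,
      hfin _ (N + j) _ (by omega) h (pairSize_one_le hw0 hper hq hstep heq (N + j))⟩⟩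
    all_goals
      refine le_trans ?_ (le_abs_self _)
      push_cast
      linarith [(Nat.cast_nonneg j : (0 : ℝ) ≤ j)]
  -- The extra `1` keeps the right-hand neighbour `-(N + j)` at modulus at least `N`; the number of
  -- steps is still at most `2 * N`.
  · refine ⟨fun j => -((N + j + 1 : ℕ) : ℤ), fun a b hab => by simpa using hab, fun j hj => ⟨?_, ?_,
      hfin _ (N + j + 1) _ (by omega) h (pairSize_zero_le hw0 hper hq hstep heq (N + j + 1))⟩⟩
    all_goals
      refine le_trans ?_ (neg_le_abs _)
      push_cast
      linarith [(Nat.cast_nonneg j : (0 : ℝ) ≤ j)]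

/-! ### From bounds at sites to moments and growth exponents -/

/-- Lower bounds for the moment from lower bounds on pairs of neighbouring sites. -/
theorem le_avgMoment {H : Hilb →L[ℂ] Hilb} (hH : IsSelfAdjoint H) (ψ : Hilb) {p : ℝ} (hp : 0 ≤ p)
    {T : ℝ} (hT : 0 < T) {N : ℕ} (hN : 1 ≤ N) {c : ℝ} (hc : 0 ≤ c) {g : ℕ → ℤ} (hg : g.Injective)
    (hgN : ∀ j < N, (N : ℝ) ≤ |(g j : ℝ)| ∧ (N : ℝ) ≤ |((g j + 1 : ℤ) : ℝ)| ∧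
      c ≤ N * (‖laplace H ψ (2 / T) (g j)‖ + ‖laplace H ψ (2 / T) (g j + 1)‖)) :
    ENNReal.ofReal ((N : ℝ) ^ p * c ^ 2 / (2 * T ^ 2 * N)) ≤ avgMoment H ψ p T := by
  have hN0 : (0 : ℝ) < N := by exact_mod_cast hN
  set F : ℤ → ℝ≥0∞ := fun n => ENNReal.ofReal (|(n : ℝ)| ^ p) * avgProb H ψ n T with hF
  have hFle : ∀ n : ℤ, (N : ℝ) ≤ |(n : ℝ)| →
      ENNReal.ofReal ((N : ℝ) ^ p * (2 / T ^ 2 * ‖laplace H ψ (2 / T) n‖ ^ 2)) ≤ F n := by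
    intro n hn
    rw [ENNReal.ofReal_mul (by positivity)]
    exact mul_le_mul' (ENNReal.ofReal_le_ofReal (Real.rpow_le_rpow hN0.le hn hp))
      (le_avgProb hH ψ n hT)
  have hpair : ∀ j < N, ENNReal.ofReal ((N : ℝ) ^ p * (c ^ 2 / (T ^ 2 * N ^ 2))) ≤
      F (g j) + F (g j + 1) := by
    intro j hj
    obtain ⟨h1, h2, h3⟩ := hgN j hj
    refine le_trans ?_ (add_le_add (hFle _ h1) (hFle _ h2))
    rw [← ENNReal.ofReal_add (by positivity) (by positivity), ← mul_add, ← mul_add]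
    refine ENNReal.ofReal_le_ofReal (mul_le_mul_of_nonneg_left ?_ (by positivity))
    set a := ‖laplace H ψ (2 / T) (g j)‖
    set b := ‖laplace H ψ (2 / T) (g j + 1)‖
    have h4 : c ^ 2 ≤ N ^ 2 * (2 * (a ^ 2 + b ^ 2)) := by
      calc c ^ 2 ≤ (N * (a + b)) ^ 2 := pow_le_pow_left₀ hc h3 2
        _ = N ^ 2 * (a + b) ^ 2 := by ring
        _ ≤ _ := by
          gcongr
          linarith [sq_nonneg (a - b)]
    rw [div_le_iff₀ (by positivity)]
    calc c ^ 2 ≤ _ := h4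
      _ = _ := by field_simp
  have hsum1 : ∑ j ∈ Finset.range N, F (g j) ≤ avgMoment H ψ p T :=
    (ENNReal.sum_le_tsum _).trans (ENNReal.tsum_comp_le_tsum_of_injective hg F)
  have hsum2 : ∑ j ∈ Finset.range N, F (g j + 1) ≤ avgMoment H ψ p T :=
    (ENNReal.sum_le_tsum _).trans
      (ENNReal.tsum_comp_le_tsum_of_injective (f := fun j => g j + 1)
        (fun a b h => hg (add_right_cancel h)) F)
  -- Consecutive pairs may overlap, but the left sites are distinct and so are the right sites: the
  -- moment is counted at most twice.
  have htot : (N : ℝ≥0∞) * ENNReal.ofReal ((N : ℝ) ^ p * (c ^ 2 / (T ^ 2 * N ^ 2))) ≤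
      2 * avgMoment H ψ p T := by
    rw [two_mul]
    refine le_trans ?_ (add_le_add hsum1 hsum2)
    rw [← Finset.sum_add_distrib, ← nsmul_eq_mul]
    simpa using Finset.card_nsmul_le_sum (Finset.range N) _ _
      (fun j hj => hpair j (Finset.mem_range.1 hj))
  rw [← ENNReal.ofReal_natCast, ← ENNReal.ofReal_mul hN0.le, mul_comm 2,
    ← ENNReal.div_le_iff_le_mul (by simp) (by simp)] at htot
  refine le_trans (le_of_eq ?_) htot
  rw [← ENNReal.ofReal_ofNat 2, ← ENNReal.ofReal_div_of_pos (by norm_num)]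
  congr 1
  field_simp

/-- A power-law lower bound on the moments gives a lower bound on the growth exponent. -/
theorem le_betaMinus {H : Hilb →L[ℂ] Hilb} {ψ : Hilb} {p s c : ℝ} (hc : 0 < c)
    (h : ∀ᶠ T : ℝ in Filter.atTop, ENNReal.ofReal (c * T ^ s) ≤ avgMoment H ψ p T) :
    (s : EReal) ≤ betaMinus H ψ p := by
  refine EReal.ge_of_forall_gt_iff_ge.1 fun r hr => ?_
  have hr' : r < s := by exact_mod_cast hr
  refine Filter.le_liminf_of_le (by isBoundedDefault) ?_
  -- For `r < s` the surplus `T ^ (s - r)` eventually absorbs the constant `c`.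
  filter_upwards [h, Filter.eventually_gt_atTop 1,
    (tendsto_rpow_atTop (sub_pos.2 hr')).eventually_ge_atTop c⁻¹] with T hT hT1 hTc
  have hT0 : 0 < T := by linarith
  have hle : T ^ r ≤ c * T ^ s := by
    have := mul_le_mul_of_nonneg_left hTc (mul_pos hc (Real.rpow_pos_of_pos hT0 r)).le
    rw [mul_assoc c (T ^ r) (T ^ (s - r)), ← Real.rpow_add hT0, add_sub_cancel,
      mul_comm c (T ^ r), mul_assoc, mul_inv_cancel₀ hc.ne', mul_one] at this
    exact this
  rw [EReal.le_div_iff_mul_le (by exact_mod_cast Real.log_pos hT1) (EReal.coe_ne_top _)]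
  calc (r : EReal) * (Real.log T : EReal) = ENNReal.log (ENNReal.ofReal (T ^ r)) := by
        rw [ENNReal.log_ofReal_of_pos (Real.rpow_pos_of_pos hT0 r), Real.log_rpow hT0,
          EReal.coe_mul]
    _ ≤ _ := ENNReal.log_monotone ((ENNReal.ofReal_le_ofReal hle).trans hT)

end QuantumDynamics

namespace PeriodDoubling

/-! ### The period doubling potential -/

theorem getElem?_subst_two_mul {w : List (Fin 2)} {i : ℕ} (h : i < w.length) :
    (subst w)[2 * i]? = some 0 := by
  induction w generalizing i with
  | nil => simp at h
  | cons a w ih =>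
    have ha : ∃ b, substLetter a = [0, b] := by unfold substLetter; split <;> exact ⟨_, rfl⟩
    obtain ⟨b, hb⟩ := ha
    have e : subst (a :: w) = 0 :: b :: subst w := by simp [subst, hb]
    rw [e]
    cases i with
    | zero => rfl
    | succ i =>
      rw [show 2 * (i + 1) = 2 * i + 1 + 1 by ring, List.getElem?_cons_succ,
        List.getElem?_cons_succ]
      exact ih (by simpa using h)

theorem fixedPoint_of_even {n : ℕ} (hn : Even n) : fixedPoint n = 0 := by
  obtain ⟨i, rfl⟩ := hn
  have hlt : i < 2 ^ i := Nat.lt_two_pow_self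
  have h1 : (word (i + 1))[i + i]? = some (fixedPoint (i + i)) :=
    getElem?_word (by rw [pow_succ]; omega)
  rw [word_succ, ← two_mul, getElem?_subst_two_mul (by rw [length_word]; exact hlt)] at h1
  rw [← two_mul]
  exact (Option.some.inj h1).symm

/-- Every element of the subshift vanishes on a sublattice of index two. -/
theorem exists_forall_even_eq_zero {ω : ℤ → Fin 2} (hω : ω ∈ subshift) :
    ∃ σ : ℤ, ∀ n, Even (n + σ) → ω n = 0 := by
  by_contra! h
  obtain ⟨a, ha, ha0⟩ := h 0
  obtain ⟨b, hb, hb0⟩ := h 1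
  -- A window containing both `a` and `b` occurs in `u`. As `a` is even and `b` odd, one of them
  -- lands on an even position of `u`, where the letter is `0`.
  obtain ⟨j, hj⟩ := hω (min a b) ((max a b - min a b).toNat + 1)
  have key : ∀ n, min a b ≤ n → n ≤ max a b → ω n ≠ 0 → ¬ Even ((j : ℤ) + (n - min a b)) := by
    intro n h1 h2 hn he
    have h3 := hj (n - min a b).toNat (by omega)
    rw [Int.toNat_of_nonneg (by omega), add_sub_cancel] at h3
    refine hn (h3.trans (fixedPoint_of_even ?_))
    rw [← Int.even_coe_nat]
    push_cast
    rwa [Int.toNat_of_nonneg (by omega)]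
  have k1 := key a (min_le_left _ _) (le_max_left _ _) ha0
  have k2 := key b (min_le_right _ _) (le_max_right _ _) hb0
  rw [Int.even_iff] at ha hb k1 k2
  omega

open QuantumDynamics in
/-- The Laplace transform of the period doubling evolution decays at most like `N⁻¹` at `N` pairs
of sites of modulus at least `N`, where `N ^ 2 ≤ T / 2`. -/
theorem exists_sites_le_laplace (lam : ℝ) {ω : ℤ → Fin 2} (hω : ω ∈ subshift) {N : ℕ}
    (hN : 1 ≤ N) {T : ℝ} (hT : 0 < T) (hNT : 2 / T ≤ 1 / (N : ℝ) ^ 2) :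
    ∃ g : ℕ → ℤ, g.Injective ∧ ∀ j < N, (N : ℝ) ≤ |(g j : ℝ)| ∧ (N : ℝ) ≤ |((g j + 1 : ℤ) : ℝ)| ∧
      Real.exp (-(2 * (|lam| + 1))) / (2 * (|lam| + 1)) ≤
        N * (‖laplace (hamiltonian lam ω) (delta 1) (2 / T) (g j)‖ +
          ‖laplace (hamiltonian lam ω) (delta 1) (2 / T) (g j + 1)‖) := by
  obtain ⟨σ, hσ⟩ := exists_forall_even_eq_zero hω
  have hε : 0 < 2 / T := by positivity
  have hN1 : (1 : ℝ) ≤ N := by exact_mod_cast hN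
  have hres := laplace_resolvent_eq (potential lam ω) (delta 1) hε
  have hz : ‖Complex.I * ((2 / T : ℝ) : ℂ)‖ = 2 / T := by
    rw [norm_mul, Complex.norm_I, one_mul, Complex.norm_real, Real.norm_of_nonneg hε.le]
  have hVle : ∀ n, |potential lam ω n| ≤ |lam| := fun n => by
    have h : ((ω n : ℕ) : ℝ) ≤ 1 := by exact_mod_cast Nat.le_of_lt_succ (ω n).isLt
    change |lam * ((ω n : ℕ) : ℝ)| ≤ _
    rw [abs_mul, Nat.abs_cast]
    exact mul_le_of_le_one_right (abs_nonneg _) h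
  refine exists_sites_le_norm_add_norm (V := fun n => potential lam ω n)
    (z := Complex.I * ((2 / T : ℝ) : ℂ)) (σ := σ) hN (by linarith [abs_nonneg lam])
    (hz.trans_le hNT) (fun n => ?_) (fun n hn => ?_) (fun n hn => ?_) ?_
  · refine (norm_sub_le _ _).trans ?_
    rw [hz, Complex.norm_real, add_comm]
    -- The `1` in `K = |lam| + 1` pays for the energy, as `2 / T ≤ 1 / N ^ 2 ≤ 1`.
    refine add_le_add (hVle n) (hNT.trans ?_)
    exact div_le_one_of_le₀ (one_le_pow₀ hN1) (by positivity)
  · change lam * ((ω n : ℕ) : ℝ) = 0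
    simp [hσ n hn]
  · have h := hres n
    rw [delta, lp.single_apply_ne _ _ _ hn, mul_zero, sub_zero] at h
    exact h
  · have h := hres 1
    rw [delta, lp.single_apply_self] at h
    have h' : ∀ x y v z : ℂ, x + y + v = z - Complex.I * 1 → ‖x + y + v - z‖ = 1 := by
      intro x y v z h
      rw [h, show z - Complex.I * 1 - z = -Complex.I by ring, norm_neg, Complex.norm_I]
    exact h' _ _ _ _ h

open QuantumDynamics in
/-- The lower growth exponent of the period doubling Hamiltonian is at least `(p - 5) / 2`. -/
theorem le_betaMinus_hamiltonian (lam : ℝ) (ω : ℤ → Fin 2) (hω : ω ∈ subshift)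
    (p : ℝ) (hp : 0 < p) :
    (((p - 5) / 2 : ℝ) : EReal) ≤
      betaMinus (hamiltonian lam ω)
        (delta 1) p := by
  set c := Real.exp (-(2 * (|lam| + 1))) / (2 * (|lam| + 1)) with hcdef
  have hc : 0 < c := by positivity
  refine le_betaMinus (c := c ^ 2 / (2 * 4 ^ p)) (by positivity) ?_
  filter_upwards [Filter.eventually_ge_atTop 2] with T hT
  have hT0 : 0 < T := by linarith
  have hs1 : 1 ≤ √(T / 2) := Real.one_le_sqrt.2 (by linarith)
  -- The largest `N` with `2 / T ≤ 1 / N ^ 2`. Below, `N ≥ √T / 4` serves for the factor `N ^ p`,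
  -- whence the constant `4 ^ p`, and `N ≤ √T` for the denominator.
  set N := ⌊√(T / 2)⌋₊ with hNdef
  have hN : 1 ≤ N := Nat.le_floor (by simpa using hs1)
  have hN1 : (1 : ℝ) ≤ N := by exact_mod_cast hN
  have hN0 : (0 : ℝ) < N := by linarith
  have hNle : (N : ℝ) ≤ √(T / 2) := Nat.floor_le (by positivity)
  have hNsq : (N : ℝ) ^ 2 ≤ T / 2 := by
    rw [← Real.sq_sqrt (by positivity : 0 ≤ T / 2)]
    exact pow_le_pow_left₀ hN0.le hNle 2
  have hNlt : √(T / 2) < N + 1 := Nat.lt_floor_add_one _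
  have hNub : (N : ℝ) ≤ √T := hNle.trans (Real.sqrt_le_sqrt (by linarith))
  have hNlb : √T / 4 ≤ N := by
    have : √T ≤ 2 * √(T / 2) := by
      rw [Real.sqrt_le_left (by positivity), mul_pow, Real.sq_sqrt (by positivity)]
      linarith
    linarith
  have hNT : 2 / T ≤ 1 / (N : ℝ) ^ 2 := by
    rw [div_le_div_iff₀ hT0 (by positivity)]
    linarith
  obtain ⟨g, hg, hgN⟩ := exists_sites_le_laplace lam hω hN hT0 hNT
  refine le_trans (ENNReal.ofReal_le_ofReal ?_)
    (le_avgMoment (isSelfAdjoint_schrodinger _) (delta 1) hp.le hT0 hN hc.le hg hgN)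
  have hpow : T ^ ((p - 5) / 2) = √T ^ p / (T ^ 2 * √T) := by
    rw [Real.sqrt_eq_rpow, ← Real.rpow_mul hT0.le, ← Real.rpow_natCast T 2, ← Real.rpow_add hT0,
      ← Real.rpow_sub hT0]
    congr 1
    push_cast
    ring
  calc c ^ 2 / (2 * 4 ^ p) * T ^ ((p - 5) / 2)
      = (√T / 4) ^ p * c ^ 2 / (2 * T ^ 2 * √T) := by
        rw [hpow, Real.div_rpow (by positivity) (by norm_num)]
        field_simp
    _ ≤ (N : ℝ) ^ p * c ^ 2 / (2 * T ^ 2 * N) := by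
        gcongr

end PeriodDoubling

theorem theorem3 (lam : ℝ) (ω : ℤ → Fin 2) (hω : ω ∈ PeriodDoubling.subshift)
    (p : ℝ) (hp : 0 < p) :
    (((p - 5) / 2 : ℝ) : EReal) ≤
      QuantumDynamics.betaMinus (PeriodDoubling.hamiltonian lam ω)
        (QuantumDynamics.delta 1) p :=
  PeriodDoubling.le_betaMinus_hamiltonian lam ω hω p hp
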